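/- Let $A$ and $B$ be complex $n\times n$ matrices. Call square complex matrices $X,Y$ of the same size \emph{unitarily similar} if $X=UYU^{*}$ for some unitary matrix $U$, and \emph{unitarily congruent} if $X=UYU^{T}$ for some unitary matrix $U$. For a complex $n\times n$ matrix $X$, let $\bar X$ be its entrywise complex conjugate and let $$K_X=\begin{bmatrix}0&I_n&XX^{*}&X\bar X\\0&0&I_n&X^{T}\bar X\\0&0&0&I_n\\0&0&0&0\end{bmatrix},\qquad K'_X=\begin{bmatrix}0&I_n&XX^{*}&X\bar X\\0&0&I_n&0\\0&0&0&I_n\\0&0&0&0\end{bmatrix}$$ ($4n\times 4n$ block matrices with $n\times n$ blocks). Then $A$ and $B$ are unitarily congruent if and only if $K_A$ and $K_B$ are unitarily similar. If $A$ or $B$ is nonsingular, then $A$ and $B$ are unitarily congruent if and only if $K'_A$ and $K'_B$ are unitarily similar. -/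

import Mathlib

open scoped Matrix

/-- `A` and `B` are unitarily similar: `A = U B U*` for some unitary `U`. -/
def UnitarilySimilar {ι : Type*} [Fintype ι] [DecidableEq ι] (A B : Matrix ι ι ℂ) : Prop :=
  ∃ U ∈ Matrix.unitaryGroup ι ℂ, A = U * B * Uᴴ

/-- `A` and `B` are unitarily congruent: `A = U B Uᵀ` for some unitary `U`. -/
def UnitarilyCongruent {ι : Type*} [Fintype ι] [DecidableEq ι] (A B : Matrix ι ι ℂ) : Prop :=
  ∃ U ∈ Matrix.unitaryGroup ι ℂ, A = U * B * Uᵀ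

/-- The entrywise complex conjugate of a matrix. -/
def conjMatrix {ι : Type*} (A : Matrix ι ι ℂ) : Matrix ι ι ℂ :=
  A.map (starRingEnd ℂ)

/-- The matrix `K_A`. A 4-by-4 array of `n`-by-`n` blocks is flattened into a `4n`-by-`4n` complex
matrix, whose rows and columns are indexed by pairs (block index, index inside the block). -/
def KMatrix {n : ℕ} (A : Matrix (Fin n) (Fin n) ℂ) : Matrix (Fin 4 × Fin n) (Fin 4 × Fin n) ℂ :=
  Matrix.comp (Fin 4) (Fin 4) (Fin n) (Fin n) ℂ
    !![0, 1, A * Aᴴ, A * conjMatrix A;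
       0, 0, 1,      Aᵀ * conjMatrix A;
       0, 0, 0,      1;
       0, 0, 0,      0]

/-- The matrix `K'_A`: `K_A` with the block `AᵀĀ` replaced by `0`. -/
def KMatrix' {n : ℕ} (A : Matrix (Fin n) (Fin n) ℂ) : Matrix (Fin 4 × Fin n) (Fin 4 × Fin n) ℂ :=
  Matrix.comp (Fin 4) (Fin 4) (Fin n) (Fin n) ℂ
    !![0, 1, A * Aᴴ, A * conjMatrix A;
       0, 0, 1,      0;
       0, 0, 0,      1;
       0, 0, 0,      0]

/-! The identity blocks on the superdiagonal force a unitary `U` with `K_A U = U K_B` to be block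
diagonal with one repeated block `V`. So similarity of the `K` matrices means that `V` conjugates
the three products of `B` into those of `A`. Replacing `B` by `V B Vᵀ`, which conjugates its
products by `V`, makes the products equal. Then `[B Bᵀ]` and `[A Aᵀ]` have the same Gram matrix, so
some unitary `W` satisfies `W B = A = B Wᵀ`. A unitary square root `S = p(W)` inherits `B Sᵀ = S B`,
and `S B Sᵀ = S² B = A`. -/

/-! ### Equal Gram matrices -/

section Isometry

/-- Two linear maps into a finite-dimensional inner product space with the same pointwise norms
differ by a linear isometry of the target. -/
theorem LinearMap.exists_linearIsometry_of_norm_eq {E V : Type*} [AddCommGroup E] [Module ℂ E]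
    [NormedAddCommGroup V] [InnerProductSpace ℂ V] [FiniteDimensional ℂ V]
    (f g : E →ₗ[ℂ] V) (h : ∀ x, ‖f x‖ = ‖g x‖) :
    ∃ L : V →ₗᵢ[ℂ] V, ∀ x, L (f x) = g x := by
  have hker : LinearMap.ker f ≤ LinearMap.ker g := fun x hx => by
    rw [LinearMap.mem_ker] at hx ⊢
    rw [← norm_eq_zero, ← h, hx, norm_zero]
  let L₀ : LinearMap.range f →ₗ[ℂ] V :=
    ((LinearMap.ker f).liftQ g hker).comp f.quotKerEquivRange.symm.toLinearMap
  have hL₀ : ∀ x, L₀ ⟨f x, LinearMap.mem_range_self f x⟩ = g x := fun x => by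
    have : f.quotKerEquivRange.symm ⟨f x, LinearMap.mem_range_self f x⟩
        = (LinearMap.ker f).mkQ x := by
      rw [LinearEquiv.symm_apply_eq]
      ext
      simp
    simp [L₀, this]
  let L₁ : LinearMap.range f →ₗᵢ[ℂ] V :=
    { toLinearMap := L₀
      norm_map' := by
        rintro ⟨_, x, rfl⟩
        rw [hL₀, ← h]
        rfl }
  -- In finite dimension an isometry defined on a subspace extends to the whole space.
  refine ⟨L₁.extend, fun x => ?_⟩
  exact (L₁.extend_apply ⟨f x, LinearMap.mem_range_self f x⟩).trans (hL₀ x)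

open WithLp in
/-- Two matrices with the same Gram matrix differ by a unitary left factor. -/
theorem Matrix.exists_unitary_mul_eq_of_gram_eq {ι κ : Type*} [Fintype ι] [DecidableEq ι]
    [Fintype κ] [DecidableEq κ] (X Y : Matrix ι κ ℂ) (h : Xᴴ * X = Yᴴ * Y) :
    ∃ W ∈ Matrix.unitaryGroup ι ℂ, W * X = Y := by
  have hnorm : ∀ x, ‖Matrix.toEuclideanLin X x‖ = ‖Matrix.toEuclideanLin Y x‖ := by
    have key : ∀ (Z : Matrix ι κ ℂ) (x : EuclideanSpace ℂ κ),
        inner ℂ (Matrix.toEuclideanLin Z x) (Matrix.toEuclideanLin Z x)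
          = ((Zᴴ * Z) *ᵥ ofLp x) ⬝ᵥ star (ofLp x) := by
      intro Z x
      rw [EuclideanSpace.inner_eq_star_dotProduct]
      simp only [Matrix.ofLp_toLpLin, Matrix.toLin'_apply]
      rw [Matrix.star_mulVec, dotProduct_comm, ← Matrix.dotProduct_mulVec, Matrix.mulVec_mulVec,
        dotProduct_comm]
    intro x
    rw [norm_eq_sqrt_re_inner (𝕜 := ℂ), norm_eq_sqrt_re_inner (𝕜 := ℂ), key, key, h]
  obtain ⟨L, hL⟩ := LinearMap.exists_linearIsometry_of_norm_eq _ _ hnorm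
  let T : EuclideanSpace ℂ ι →L[ℂ] EuclideanSpace ℂ ι := L.toContinuousLinearMap
  let e := Matrix.toEuclideanCLM (n := ι) (𝕜 := ℂ)
  have hT : star T * T = 1 := by
    rw [ContinuousLinearMap.star_eq_adjoint]
    exact (ContinuousLinearMap.norm_map_iff_adjoint_comp_self T).mp L.norm_map
  obtain ⟨W, hW⟩ : ∃ W, e W = T := e.surjective T
  refine ⟨W, ?_, ?_⟩
  · rw [Matrix.mem_unitaryGroup_iff']
    refine EquivLike.injective e ?_
    rw [map_mul, map_star, hW, hT, map_one]
  · apply Matrix.toEuclideanLin.injective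
    ext1 x
    rw [← hL x]
    change _ = T _
    rw [← hW]
    apply ofLp_injective
    simp [e, Matrix.ofLp_toEuclideanCLM, Matrix.mulVec_mulVec]

end Isometry

/-! ### Polynomial unitary square roots -/

section SquareRoot

open Polynomial

/-- If `W A = A W'`, the same holds with a polynomial applied to `W` and `W'`. -/
theorem SemiconjBy.aeval {R S : Type*} [CommSemiring R] [Semiring S] [Algebra R S] {a x y : S}
    (h : SemiconjBy a x y) (p : R[X]) :
    SemiconjBy a (Polynomial.aeval x p) (Polynomial.aeval y p) := by
  induction p using Polynomial.induction_on' with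
  | add p q hp hq => simpa using hp.add_right hq
  | monomial k r =>
    simp only [Polynomial.aeval_monomial]
    exact SemiconjBy.mul_right (Algebra.commutes r a).symm (h.pow_right k)

theorem Matrix.aeval_transpose {ι R : Type*} [Fintype ι] [DecidableEq ι] [CommRing R]
    (W : Matrix ι ι R) (p : R[X]) : aeval Wᵀ p = (aeval W p)ᵀ := by
  induction p using Polynomial.induction_on' with
  | add p q hp hq => simp [hp, hq]
  | monomial k r => simp [aeval_monomial, ← Algebra.smul_def, Matrix.transpose_pow]

open scoped Matrix.Norms.L2Operator in
/-- A unitary matrix has a unitary square root that is a polynomial in it. -/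
theorem Matrix.exists_aeval_unitary_sq_eq {ι : Type*} [Fintype ι] [DecidableEq ι]
    (W : Matrix ι ι ℂ) (hW : W ∈ Matrix.unitaryGroup ι ℂ) :
    ∃ p : ℂ[X], aeval W p ∈ Matrix.unitaryGroup ι ℂ ∧ aeval W p * aeval W p = W := by
  classical
  have hfin : (spectrum ℂ W).Finite := Matrix.finite_spectrum W
  choose r hr using fun z : ℂ => IsAlgClosed.exists_eq_mul_self z
  -- `W` is normal, so `p(W)` depends only on the values of `p` on the finite spectrum; there `p`
  -- interpolates a choice of square roots.
  let p : ℂ[X] := Lagrange.interpolate hfin.toFinset id r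
  have hp : ∀ z ∈ spectrum ℂ W, p.eval z = r z := fun z hz =>
    Lagrange.eval_interpolate_at_node r (Set.injOn_id _) (hfin.mem_toFinset.mpr hz)
  have hnormal : IsStarNormal W :=
    (unitary_iff_isStarNormal_and_spectrum_subset_unitary.mp hW).1
  have hsub : spectrum ℂ W ⊆ unitary ℂ :=
    (unitary_iff_isStarNormal_and_spectrum_subset_unitary.mp hW).2
  refine ⟨p, ?_, ?_⟩
  · rw [← cfc_polynomial p W]
    refine (cfc_unitary_iff _ W).mpr fun z hz => ?_
    have hz1 : ‖z‖ = 1 := by simpa [Unitary.mem_iff_self_mul_star, Complex.mul_conj] using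
      CStarRing.norm_of_mem_unitary (hsub hz)
    have h1 : ‖r z‖ * ‖r z‖ = 1 := by rw [← norm_mul, ← hr, hz1]
    rw [hp z hz]
    simp only [RCLike.star_def]
    rw [← Complex.normSq_eq_conj_mul_self, Complex.normSq_eq_norm_sq, sq, h1, Complex.ofReal_one]
  · rw [← map_mul, ← cfc_polynomial (p * p) W]
    conv_rhs => rw [← cfc_id ℂ W]
    refine cfc_congr fun z hz => ?_
    simp only [eval_mul, hp z hz, id]
    exact (hr z).symm

end SquareRoot

/-! ### Unitary congruence through the three products -/

section Congruence

theorem conjMatrix_eq {ι : Type*} (A : Matrix ι ι ℂ) : conjMatrix A = Aᴴᵀ := rfl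

variable {ι : Type*} [Fintype ι] [DecidableEq ι]

theorem Matrix.transpose_mem_unitaryGroup {U : Matrix ι ι ℂ} (hU : U ∈ Matrix.unitaryGroup ι ℂ) :
    Uᵀ ∈ Matrix.unitaryGroup ι ℂ := by
  rw [Matrix.mem_unitaryGroup_iff, Matrix.star_eq_conjTranspose]
  change Uᵀ * Uᴴᵀ = 1
  rw [← Matrix.transpose_mul]
  rw [Matrix.mem_unitaryGroup_iff', Matrix.star_eq_conjTranspose] at hU
  rw [hU, Matrix.transpose_one]

/-- If `W A = B` and `A Wᵀ = B` for a unitary `W`, then `A` and `B` are unitarily congruent. -/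
theorem UnitarilyCongruent.of_mul_eq {A B W : Matrix ι ι ℂ} (hW : W ∈ Matrix.unitaryGroup ι ℂ)
    (h₁ : W * A = B) (h₂ : A * Wᵀ = B) : UnitarilyCongruent B A := by
  obtain ⟨p, hp, hpp⟩ := Matrix.exists_aeval_unitary_sq_eq W hW
  have hs : SemiconjBy A (Polynomial.aeval Wᵀ p) (Polynomial.aeval W p) :=
    SemiconjBy.aeval (h₂.trans h₁.symm) p
  rw [Matrix.aeval_transpose] at hs
  exact ⟨_, hp, by rw [Matrix.mul_assoc, hs.eq, ← Matrix.mul_assoc, hpp, h₁]⟩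

theorem UnitarilyCongruent.of_products_eq {A B : Matrix ι ι ℂ} (h₁ : A * Aᴴ = B * Bᴴ)
    (h₂ : A * conjMatrix A = B * conjMatrix B) (h₃ : Aᵀ * conjMatrix A = Bᵀ * conjMatrix B) :
    UnitarilyCongruent A B := by
  rw [conjMatrix_eq, conjMatrix_eq] at h₂ h₃
  -- The four blocks of the Gram matrices of `[B Bᵀ]` and `[A Aᵀ]`: `h₃` and `h₁` give the diagonal
  -- ones, `h₂` both off-diagonal ones.
  have e₁₁ : Bᴴ * B = Aᴴ * A := by simpa using congrArg Matrix.transpose h₃.symm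
  have e₁₂ : Bᴴ * Bᵀ = Aᴴ * Aᵀ := by simpa using congrArg Matrix.transpose h₂.symm
  have e₂₁ : Bᵀᴴ * B = Aᵀᴴ * A := by simpa using congrArg Matrix.conjTranspose e₁₂
  have e₂₂ : Bᵀᴴ * Bᵀ = Aᵀᴴ * Aᵀ := by
    change Bᴴᵀ * Bᵀ = Aᴴᵀ * Aᵀ
    simpa using congrArg Matrix.transpose h₁.symm
  obtain ⟨W, hW, hWB⟩ := Matrix.exists_unitary_mul_eq_of_gram_eq
    (Matrix.fromCols B Bᵀ) (Matrix.fromCols A Aᵀ) (by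
      simp only [Matrix.conjTranspose_fromCols_eq_fromRows_conjTranspose,
        Matrix.fromRows_mul_fromCols, e₁₁, e₁₂, e₂₁, e₂₂])
  rw [Matrix.mul_fromCols, Matrix.fromCols_inj.eq_iff] at hWB
  refine .of_mul_eq hW hWB.1 ?_
  simpa using congrArg Matrix.transpose hWB.2

/-- By `h₁`, `Z = B⁻¹A` is unitary. Cancelling `B` in `h₂` gives `Z Ā = B̄`, whose conjugate
transpose is `Aᵀ Z* = Bᵀ`; in the product `Bᵀ B̄` the factor `Z* Z` disappears. -/
theorem Matrix.transpose_mul_conj_eq_of_isUnit {A B : Matrix ι ι ℂ} (hB : IsUnit B)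
    (h₁ : A * Aᴴ = B * Bᴴ) (h₂ : A * conjMatrix A = B * conjMatrix B) :
    Aᵀ * conjMatrix A = Bᵀ * conjMatrix B := by
  obtain ⟨C, hBC, hCB⟩ := isUnit_iff_exists.mp hB
  rw [conjMatrix_eq, conjMatrix_eq] at *
  set Z := C * A with hZ
  have hZu : Z * Zᴴ = 1 := by
    calc Z * Zᴴ = C * (A * Aᴴ) * Cᴴ := by simp only [hZ, Matrix.conjTranspose_mul, Matrix.mul_assoc]
      _ = (C * B) * (C * B)ᴴ := by
        rw [h₁]; simp only [Matrix.conjTranspose_mul, Matrix.mul_assoc]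
      _ = 1 := by simp [hCB]
  have hBZ : A = B * Z := by rw [hZ, ← Matrix.mul_assoc, hBC, Matrix.one_mul]
  have hconj : Z * Aᴴᵀ = Bᴴᵀ := by rw [hZ, Matrix.mul_assoc, h₂, ← Matrix.mul_assoc, hCB, Matrix.one_mul]
  have hT : Aᵀ * Zᴴ = Bᵀ := by
    have hct : ∀ M : Matrix ι ι ℂ, Mᴴᵀᴴ = Mᵀ := fun M => by ext; simp
    simpa [hct] using congrArg Matrix.conjTranspose hconj
  rw [← hconj, ← hT, Matrix.mul_assoc, ← Matrix.mul_assoc Zᴴ, mul_eq_one_comm.mp hZu,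
    Matrix.one_mul]

theorem UnitarilyCongruent.trans_eq {A B V : Matrix ι ι ℂ} (hV : V ∈ Matrix.unitaryGroup ι ℂ)
    (h : UnitarilyCongruent A (V * B * Vᵀ)) : UnitarilyCongruent A B := by
  obtain ⟨U, hU, rfl⟩ := h
  exact ⟨U * V, mul_mem hU hV, by simp only [Matrix.transpose_mul, Matrix.mul_assoc]⟩

theorem Matrix.congr_mul_conjTranspose {B V : Matrix ι ι ℂ} (hV : V ∈ Matrix.unitaryGroup ι ℂ) :
    (V * B * Vᵀ) * (V * B * Vᵀ)ᴴ = V * (B * Bᴴ) * Vᴴ := by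
  have h := Matrix.mem_unitaryGroup_iff.mp (Matrix.transpose_mem_unitaryGroup hV)
  rw [Matrix.star_eq_conjTranspose] at h
  calc _ = V * B * (Vᵀ * Vᵀᴴ) * Bᴴ * Vᴴ := by
        simp only [Matrix.conjTranspose_mul, Matrix.mul_assoc]
    _ = _ := by rw [h]; simp only [Matrix.mul_one, Matrix.mul_assoc]

theorem Matrix.congr_mul_conj {B V : Matrix ι ι ℂ} (hV : V ∈ Matrix.unitaryGroup ι ℂ) :
    (V * B * Vᵀ) * conjMatrix (V * B * Vᵀ) = V * (B * conjMatrix B) * Vᴴ := by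
  have h := Matrix.mem_unitaryGroup_iff.mp (Matrix.transpose_mem_unitaryGroup hV)
  rw [Matrix.star_eq_conjTranspose] at h
  simp only [conjMatrix_eq]
  calc _ = V * B * (Vᵀ * Vᵀᴴ) * Bᴴᵀ * Vᴴ := by
        simp only [Matrix.conjTranspose_mul, Matrix.transpose_mul, Matrix.mul_assoc]
        rfl
    _ = _ := by rw [h]; simp only [Matrix.mul_one, Matrix.mul_assoc]

theorem Matrix.congr_transpose_mul_conj {B V : Matrix ι ι ℂ}
    (hV : V ∈ Matrix.unitaryGroup ι ℂ) :
    (V * B * Vᵀ)ᵀ * conjMatrix (V * B * Vᵀ) = V * (Bᵀ * conjMatrix B) * Vᴴ := by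
  have h := Matrix.mem_unitaryGroup_iff.mp (Matrix.transpose_mem_unitaryGroup hV)
  rw [Matrix.star_eq_conjTranspose] at h
  simp only [conjMatrix_eq]
  calc _ = V * Bᵀ * (Vᵀ * Vᵀᴴ) * Bᴴᵀ * Vᴴ := by
        simp only [Matrix.conjTranspose_mul, Matrix.transpose_mul, Matrix.mul_assoc]
        rfl
    _ = _ := by rw [h]; simp only [Matrix.mul_one, Matrix.mul_assoc]

/-- Unitary congruence is simultaneous unitary similarity of `A A*`, `A Ā`, `Aᵀ Ā`. -/
theorem unitarilyCongruent_iff_products {A B : Matrix ι ι ℂ} :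
    UnitarilyCongruent A B ↔ ∃ V ∈ Matrix.unitaryGroup ι ℂ,
      A * Aᴴ = V * (B * Bᴴ) * Vᴴ ∧ A * conjMatrix A = V * (B * conjMatrix B) * Vᴴ ∧
        Aᵀ * conjMatrix A = V * (Bᵀ * conjMatrix B) * Vᴴ := by
  constructor
  · rintro ⟨V, hV, rfl⟩
    exact ⟨V, hV, Matrix.congr_mul_conjTranspose hV, Matrix.congr_mul_conj hV,
      Matrix.congr_transpose_mul_conj hV⟩
  · rintro ⟨V, hV, h₁, h₂, h₃⟩
    rw [← Matrix.congr_mul_conjTranspose hV] at h₁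
    rw [← Matrix.congr_mul_conj hV] at h₂
    rw [← Matrix.congr_transpose_mul_conj hV] at h₃
    exact .trans_eq hV (.of_products_eq h₁ h₂ h₃)

/-- In the nonsingular case the condition on `Aᵀ Ā` is redundant. -/
theorem unitarilyCongruent_iff_products_of_isUnit {A B : Matrix ι ι ℂ}
    (hAB : IsUnit A ∨ IsUnit B) :
    UnitarilyCongruent A B ↔ ∃ V ∈ Matrix.unitaryGroup ι ℂ,
      A * Aᴴ = V * (B * Bᴴ) * Vᴴ ∧ A * conjMatrix A = V * (B * conjMatrix B) * Vᴴ := by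
  constructor
  · rintro ⟨V, hV, rfl⟩
    exact ⟨V, hV, Matrix.congr_mul_conjTranspose hV, Matrix.congr_mul_conj hV⟩
  · rintro ⟨V, hV, h₁, h₂⟩
    rw [← Matrix.congr_mul_conjTranspose hV] at h₁
    rw [← Matrix.congr_mul_conj hV] at h₂
    refine .trans_eq hV (.of_products_eq h₁ h₂ ?_)
    rcases hAB with hA | hB
    · exact (Matrix.transpose_mul_conj_eq_of_isUnit hA h₁.symm h₂.symm).symm
    · refine Matrix.transpose_mul_conj_eq_of_isUnit ?_ h₁ h₂
      have hVu : IsUnit V := ⟨Unitary.toUnits ⟨V, hV⟩, rfl⟩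
      exact (hVu.mul hB).mul ((Matrix.isUnit_transpose V).mpr hVu)

end Congruence

/-! ### Unitary similarity of the block arrays -/

section Block

/-- The 4-by-4 strictly upper triangular array with identity blocks on the superdiagonal. -/
def blockArray {R : Type*} [Zero R] [One R] (a b c : R) : Matrix (Fin 4) (Fin 4) R :=
  !![0, 1, a, b;
     0, 0, 1, c;
     0, 0, 0, 1;
     0, 0, 0, 0]

/-- A matrix with orthonormal columns intertwining two such arrays is block diagonal with equal
diagonal blocks. -/
theorem eq_diagonal_of_blockArray_mul_eq {R : Type*} [Ring R] [StarRing R] [IsDedekindFiniteMonoid R]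
    {a b c a' b' c' : R} {U : Matrix (Fin 4) (Fin 4) R} (hU : Uᴴ * U = 1)
    (h : blockArray a b c * U = U * blockArray a' b' c') :
    ∃ v ∈ unitary R, U = Matrix.diagonal (fun _ => v) := by
  have e : ∀ i j, (blockArray a b c * U) i j = (U * blockArray a' b' c') i j := fun i j => by rw [h]
  have u : ∀ i j, (Uᴴ * U) i j = (1 : Matrix (Fin 4) (Fin 4) R) i j := fun i j => by rw [hU]
  simp only [Matrix.mul_apply, Fin.sum_univ_four, blockArray, Matrix.conjTranspose_apply] at e u
  -- The intertwining relation, read from the bottom row up, clears the part below the diagonal and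
  -- equates the diagonal blocks.
  have z30 : U 3 0 = 0 := by simpa using (e 3 1).symm
  have z31 : U 3 1 = 0 := by simpa [z30] using (e 3 2).symm
  have z32 : U 3 2 = 0 := by simpa [z30, z31] using (e 3 3).symm
  have z20 : U 2 0 = 0 := by simpa [z31] using (e 2 1).symm
  have z21 : U 2 1 = 0 := by simpa [z32, z20] using (e 2 2).symm
  have z10 : U 1 0 = 0 := by simpa [z21, z31] using (e 1 1).symm
  have d3 : U 3 3 = U 2 2 := by simpa [z20, z21] using e 2 3
  have d2 : U 2 2 = U 1 1 := by simpa [z32, z10] using e 1 2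
  have d1 : U 1 1 = U 0 0 := by simpa [z21, z31] using e 0 1
  have hv : star (U 0 0) * U 0 0 = 1 := by simpa [z10, z20, z30] using u 0 0
  have hv' : U 0 0 * star (U 0 0) = 1 := mul_eq_one_symm hv
  -- Since the diagonal block is invertible, orthogonality of the columns clears the part above the
  -- diagonal.
  have cancel : ∀ x, star (U 0 0) * x = 0 → x = 0 := fun x hx => by
    rw [← one_mul x, ← hv', mul_assoc, hx, mul_zero]
  have z01 : U 0 1 = 0 := cancel _ (by simpa [z10, z20, z30] using u 0 1)
  have z02 : U 0 2 = 0 := cancel _ (by simpa [z10, z20, z30] using u 0 2)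
  have z03 : U 0 3 = 0 := cancel _ (by simpa [z10, z20, z30] using u 0 3)
  have z12 : U 1 2 = 0 := cancel _ (by simpa [z01, z21, z31, d1] using u 1 2)
  have z13 : U 1 3 = 0 := cancel _ (by simpa [z01, z21, z31, d1] using u 1 3)
  have z23 : U 2 3 = 0 := cancel _ (by simpa [z02, z12, z32, d1, d2] using u 2 3)
  refine ⟨U 0 0, Unitary.mem_iff.mpr ⟨hv, hv'⟩, ?_⟩
  ext i j
  fin_cases i <;> fin_cases j <;>
    simp [z01, z02, z03, z10, z12, z13, z20, z21, z23, z30, z31, z32, d1, d2, d3]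

theorem blockArray_eq_diagonal_conj_iff {R : Type*} [Ring R] [StarRing R] {a b c a' b' c' v : R}
    (hv : v ∈ unitary R) :
    blockArray a b c = Matrix.diagonal (fun _ => v) * blockArray a' b' c' *
        (Matrix.diagonal (fun _ => v))ᴴ ↔
      a = v * a' * star v ∧ b = v * b' * star v ∧ c = v * c' * star v := by
  have h1 : v * star v = 1 := Unitary.mul_star_self_of_mem hv
  rw [Matrix.diagonal_conjTranspose]
  constructor
  · intro h
    have e := fun i j => congrFun (congrFun h i) j
    simp only [Matrix.mul_diagonal, Matrix.diagonal_mul] at e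
    exact ⟨by simpa [blockArray] using e 0 2, by simpa [blockArray] using e 0 3,
      by simpa [blockArray] using e 1 3⟩
  · rintro ⟨ha, hb, hc⟩
    ext i j
    rw [Matrix.mul_diagonal, Matrix.diagonal_mul]
    fin_cases i <;> fin_cases j <;> simp [blockArray, h1, ha, hb, hc]

theorem Matrix.comp_conjTranspose {I J R : Type*} [Star R] (M : Matrix I I (Matrix J J R)) :
    (Matrix.comp I I J J R M)ᴴ = Matrix.comp I I J J R Mᴴ := rfl

/-- Flattening is a ring isomorphism that respects the conjugate transpose, so the question can be
settled for 4-by-4 matrices over the ring of blocks. -/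
theorem unitarilySimilar_comp_blockArray_iff {n : ℕ}
    {a b c a' b' c' : Matrix (Fin n) (Fin n) ℂ} :
    UnitarilySimilar (Matrix.comp (Fin 4) (Fin 4) (Fin n) (Fin n) ℂ (blockArray a b c))
      (Matrix.comp (Fin 4) (Fin 4) (Fin n) (Fin n) ℂ (blockArray a' b' c')) ↔
    ∃ V ∈ Matrix.unitaryGroup (Fin n) ℂ,
      a = V * a' * Vᴴ ∧ b = V * b' * Vᴴ ∧ c = V * c' * Vᴴ := by
  let φ := Matrix.compRingEquiv (Fin 4) (Fin n) ℂ
  have hstar : ∀ M, (φ M)ᴴ = φ Mᴴ := Matrix.comp_conjTranspose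
  constructor
  · rintro ⟨W, hW, h⟩
    obtain ⟨U, rfl⟩ := φ.surjective W
    have hU : Uᴴ * U = 1 := by
      apply φ.injective
      rw [map_mul, map_one, ← hstar]
      exact Matrix.mem_unitaryGroup_iff'.mp hW
    have h' : blockArray a b c = U * blockArray a' b' c' * Uᴴ := by
      apply φ.injective
      rw [map_mul, map_mul, ← hstar]
      exact h
    obtain ⟨V, hV, rfl⟩ := eq_diagonal_of_blockArray_mul_eq hU (a := a) (b := b) (c := c)
      (a' := a') (b' := b') (c' := c')
      (by rw [h', Matrix.mul_assoc _ Uᴴ, hU, Matrix.mul_one])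
    exact ⟨V, hV, (blockArray_eq_diagonal_conj_iff hV).mp h'⟩
  · rintro ⟨V, hV, habc⟩
    refine ⟨φ (Matrix.diagonal fun _ => V), ?_, ?_⟩
    · rw [Matrix.mem_unitaryGroup_iff', Matrix.star_eq_conjTranspose, hstar, ← map_mul,
        ← map_one φ, Matrix.diagonal_conjTranspose, Matrix.diagonal_mul_diagonal,
        ← Matrix.diagonal_one]
      congr 2
      funext i
      exact Unitary.star_mul_self_of_mem hV
    · rw [hstar]
      exact (congrArg φ ((blockArray_eq_diagonal_conj_iff hV).mpr habc)).trans (by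
        rw [map_mul, map_mul]; rfl)

end Block

theorem mainTheorem6 (n : ℕ) (A B : Matrix (Fin n) (Fin n) ℂ) :
    (UnitarilyCongruent A B ↔ UnitarilySimilar (KMatrix A) (KMatrix B)) ∧
    ((IsUnit A ∨ IsUnit B) →
      (UnitarilyCongruent A B ↔ UnitarilySimilar (KMatrix' A) (KMatrix' B))) := by
  refine ⟨unitarilyCongruent_iff_products.trans unitarilySimilar_comp_blockArray_iff.symm,
    fun hAB => (unitarilyCongruent_iff_products_of_isUnit hAB).trans ?_⟩
  refine Iff.trans ?_ unitarilySimilar_comp_blockArray_iff.symm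
  -- For `K'` the third condition reads `0 = V * 0 * Vᴴ` and drops out.
  simp
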